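/- Let Sol be $\mathbf{R}^3$ with the group law $(x,y,z)*(a,b,c)=(e^{z}a+x,\;e^{-z}b+y,\;c+z)$ and the left-invariant Riemannian metric $e^{-2z}dx^2+e^{2z}dy^2+dz^2$. Identify the Lie algebra of Sol, that is, the tangent space at the identity $(0,0,0)$, with $\mathbf{R}^3$ through its standard basis, and let $E:\mathbf{R}^3\to\mathrm{Sol}$ be the Riemannian exponential map at the identity: $E(V)=\gamma(1)$, where $\gamma$ is the geodesic with $\gamma(0)=(0,0,0)$ and $\gamma'(0)=V$. For $V=(x,y,z)\in\mathbf{R}^3$ put $$\mu(V)=\mathrm{AGM}\Big(\sqrt{|xy|},\ \tfrac12\sqrt{(|x|+|y|)^2+z^2}\Big),$$ where $\mathrm{AGM}$ is the arithmetic-geometric mean, and call $V$ perfect if $\mu(V)=\pi$. Then $E$ is injective on the set of perfect vectors $(x,y,z)$ with $x,y,z\ge 0$: if $V_1,V_2$ are perfect vectors with all coordinates non-negative and $E(V_1)=E(V_2)$, then $V_1=V_2$. -/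

import Mathlib

noncomputable section

/-- The partial derivative `∂_l g_{ij}` at `p` of an entry of a metric tensor `g` on `ℝⁿ`, written
as a matrix-valued function in the standard coordinates. -/
def metricPartial {n : ℕ} (g : (Fin n → ℝ) → Matrix (Fin n) (Fin n) ℝ) (p : Fin n → ℝ)
    (l i j : Fin n) : ℝ :=
  fderiv ℝ (fun q : Fin n → ℝ => g q i j) p (Pi.single l 1)

/-- The Christoffel symbol `Γᵏᵢⱼ = ½ ∑ₗ gᵏˡ (∂ᵢ gⱼₗ + ∂ⱼ gᵢₗ - ∂ₗ gᵢⱼ)` at `p` of the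
Levi-Civita connection of the metric `g`. -/
def christoffel {n : ℕ} (g : (Fin n → ℝ) → Matrix (Fin n) (Fin n) ℝ) (p : Fin n → ℝ)
    (k i j : Fin n) : ℝ :=
  (1 / 2 : ℝ) * ∑ l : Fin n, (g p)⁻¹ k l *
    (metricPartial g p i j l + metricPartial g p j i l - metricPartial g p l i j)

/-- `γ : ℝ → ℝⁿ` is a (complete, affinely parametrized) geodesic of the metric `g`: it is `C²` and
satisfies `γ''ᵏ + ∑ᵢⱼ Γᵏᵢⱼ(γ) γ'ⁱ γ'ʲ = 0`. -/
def IsRiemannianGeodesic {n : ℕ} (g : (Fin n → ℝ) → Matrix (Fin n) (Fin n) ℝ)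
    (γ : ℝ → Fin n → ℝ) : Prop :=
  ContDiff ℝ 2 γ ∧ ∀ (t : ℝ) (k : Fin n),
    deriv (deriv γ) t k +
      ∑ i : Fin n, ∑ j : Fin n, christoffel g (γ t) k i j * deriv γ t i * deriv γ t j = 0

open Classical in
/-- The Riemannian exponential map at `p` of a geodesically complete metric `g` on `ℝⁿ`: the value
at time `1` of the geodesic that starts at `p` with velocity `V`. (For a complete smooth metric
this geodesic exists and is unique, so the default value `p` is never used.) -/
def riemannianExp {n : ℕ} (g : (Fin n → ℝ) → Matrix (Fin n) (Fin n) ℝ) (p V : Fin n → ℝ) :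
    Fin n → ℝ :=
  if h : ∃ γ : ℝ → Fin n → ℝ, IsRiemannianGeodesic g γ ∧ γ 0 = p ∧ deriv γ 0 = V then
    h.choose 1
  else p

/-- The left-invariant metric `e^{-2z} dx² + e^{2z} dy² + dz²` of Sol, whose underlying manifold is
`ℝ³` with coordinates `(x, y, z) = (p 0, p 1, p 2)` and whose identity element is the origin. -/
def solMetric (p : Fin 3 → ℝ) : Matrix (Fin 3) (Fin 3) ℝ :=
  Matrix.diagonal ![Real.exp (-2 * p 2), Real.exp (2 * p 2), 1]

/-- The Riemannian exponential map `E` of Sol at the identity. The Lie algebra of Sol, i.e. the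
tangent space at the origin, is `ℝ³` with its standard basis. -/
def solExp (V : Fin 3 → ℝ) : Fin 3 → ℝ :=
  riemannianExp solMetric 0 V

/-- `μ(x, y, z) = AGM(√|xy|, ½ √((|x| + |y|)² + z²))`. -/
def solMu (V : Fin 3 → ℝ) : ℝ :=
  (NNReal.agm (Real.toNNReal (Real.sqrt |V 0 * V 1|))
    (Real.toNNReal ((1 / 2) * Real.sqrt ((|V 0| + |V 1|) ^ 2 + V 2 ^ 2))) : ℝ)

/-- A vector of the Lie algebra of Sol is perfect when `μ(V) = π`. -/
def IsPerfect (V : Fin 3 → ℝ) : Prop :=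
  solMu V = Real.pi

end

/-!
# Injectivity of the exponential map of Sol on perfect vectors of the positive octant

Along a geodesic `(x, y, z)` of Sol from the origin with initial velocity `(a, b, c)`, invariance
under translations in `x` and `y` gives `x' = a e^{2z}` and `y' = b e^{-2z}`, so that the height
satisfies the autonomous equation `z'' = b² e^{-2z} - a² e^{2z}`. A perfect vector in the closed
octant has `a, b > 0`, since `AGM(0, ·) = 0`. Put `α = √(ab)` and `w = z + ½ log (a / b)`; then
`w'² = 4 α² (A² - sinh² w)` with `4 α² A² = (a - b)² + c²`, and `sinh w = A sin θ` turns this into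
`θ' = 2 α √(1 + A² sin² θ)`. Hence `w` is explicit in the phase `θ`, which is obtained by
separation of variables; this gives both the existence of the geodesic and, by uniqueness for the
height equation (`IsSolHeight.eqOn_Icc`), the value of the exponential map.

A full turn of `θ` takes time `(1 / 2α) ∫₀^{2π} dθ / √(1 + A² sin² θ)`, which by Gauss's formula
(`gaussIntegral_eq_two_pi_div_agm`) equals `π / AGM(α, α √(1 + A²))`, and
`α √(1 + A²) = ½ √((a + b)² + c²)`. So for perfect vectors the time `1` is exactly one period
(`IsPerfect.ellipticPeriod_eq`). Integrating `x'` and `y'` over a period, the `sinh 2w` part of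
`e^{±2w}` drops out and the first two coordinates of the exponential map are `(b, a) H(A) / (2α)`
with `H(A) = ∫₀^{2π} (1 + 2 A² sin² θ) / √(1 + A² sin² θ) dθ` (`solExp_of_ellipticPeriod_eq`).

The product of these coordinates is `H(A)² / 4`, and `H` is strictly increasing on `[0, ∞)` because
its integrand is (`ellipticHolonomy_strictMonoOn`). So the endpoint determines `A`, then `α` through
the period condition, then `a` and `b` from the coordinates, and finally `c ≥ 0` from
`4 α² A² = (a - b)² + c²`.
-/

open MeasureTheory Set Filter Topology
open scoped NNReal

/-! ### Gauss's formula for the arithmetic-geometric mean -/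

/-- The complete elliptic integral `∫₀^{2π} dθ / √(a² cos² θ + b² sin² θ)`, over a full turn. -/
noncomputable def gaussIntegral (a b : ℝ) : ℝ :=
  ∫ θ in (0)..(2 * Real.pi), (√(a ^ 2 * Real.cos θ ^ 2 + b ^ 2 * Real.sin θ ^ 2))⁻¹

theorem quadratic_cos_sin_pos {a b : ℝ} (ha : 0 < a) (hb : 0 < b) (θ : ℝ) :
    0 < a ^ 2 * Real.cos θ ^ 2 + b ^ 2 * Real.sin θ ^ 2 := by
  rcases eq_or_ne (Real.sin θ) 0 with h | h
  · have := Real.sin_sq_add_cos_sq θ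
    have : Real.cos θ ^ 2 = 1 := by rw [h] at this; linarith
    rw [h, this]; positivity
  · positivity

theorem continuous_gaussIntegrand {a b : ℝ} (ha : 0 < a) (hb : 0 < b) :
    Continuous fun θ : ℝ => (√(a ^ 2 * Real.cos θ ^ 2 + b ^ 2 * Real.sin θ ^ 2))⁻¹ := by
  refine Continuous.inv₀ (by fun_prop) fun θ => ?_
  exact (Real.sqrt_pos.2 (quadratic_cos_sin_pos ha hb θ)).ne'

/-- The substitution `t = b tan θ`. -/
theorem gaussIntegral_eq_integral_line {a b : ℝ} (ha : 0 < a) (hb : 0 < b) :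
    gaussIntegral a b = 2 * ∫ t : ℝ, (√((t ^ 2 + a ^ 2) * (t ^ 2 + b ^ 2)))⁻¹ := by
  have hper : Function.Periodic
      (fun θ : ℝ => (√(a ^ 2 * Real.cos θ ^ 2 + b ^ 2 * Real.sin θ ^ 2))⁻¹) Real.pi := by
    intro θ
    simp [Real.cos_add_pi, Real.sin_add_pi]
  have hint : ∀ u v : ℝ, IntervalIntegrable
      (fun θ : ℝ => (√(a ^ 2 * Real.cos θ ^ 2 + b ^ 2 * Real.sin θ ^ 2))⁻¹) volume u v :=
    fun u v => (continuous_gaussIntegrand ha hb).intervalIntegrable u v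
  have h1 : gaussIntegral a b = 2 * ∫ θ in (-(Real.pi / 2))..(Real.pi / 2),
      (√(a ^ 2 * Real.cos θ ^ 2 + b ^ 2 * Real.sin θ ^ 2))⁻¹ := by
    have e1 := hper.intervalIntegral_add_eq (-(Real.pi / 2)) 0
    have e2 := hper.intervalIntegral_add_eq (-(Real.pi / 2)) Real.pi
    rw [show -(Real.pi / 2) + Real.pi = Real.pi / 2 by ring] at e1 e2
    rw [gaussIntegral, ← intervalIntegral.integral_add_adjacent_intervals (hint 0 Real.pi)
      (hint Real.pi _), two_mul Real.pi, ← e2]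
    rw [zero_add] at e1
    rw [← e1]; ring
  have hder : ∀ θ ∈ Ioo (-(Real.pi / 2)) (Real.pi / 2),
      HasDerivWithinAt (fun θ => b * Real.tan θ) (b * (1 / Real.cos θ ^ 2))
        (Ioo (-(Real.pi / 2)) (Real.pi / 2)) θ := fun θ hθ =>
    ((Real.hasDerivAt_tan_of_mem_Ioo hθ).const_mul b).hasDerivWithinAt
  have hinj : InjOn (fun θ => b * Real.tan θ) (Ioo (-(Real.pi / 2)) (Real.pi / 2)) :=
    fun x hx y hy hxy => Real.injOn_tan hx hy (mul_left_cancel₀ hb.ne' hxy)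
  have himg : (fun θ => b * Real.tan θ) '' Ioo (-(Real.pi / 2)) (Real.pi / 2) = univ := by
    refine eq_univ_of_forall fun t => ?_
    refine ⟨Real.arctan (t / b), Real.arctan_mem_Ioo _, ?_⟩
    simp only [Real.tan_arctan]; field_simp
  have h2 := integral_image_eq_integral_abs_deriv_smul measurableSet_Ioo hder hinj
    (fun t : ℝ => (√((t ^ 2 + a ^ 2) * (t ^ 2 + b ^ 2)))⁻¹)
  rw [himg, setIntegral_univ] at h2
  rw [h1, h2, intervalIntegral.integral_of_le (by linarith [Real.pi_pos]),
    integral_Ioc_eq_integral_Ioo]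
  congr 1
  refine setIntegral_congr_fun measurableSet_Ioo fun θ hθ => ?_
  have hc : 0 < Real.cos θ := Real.cos_pos_of_mem_Ioo hθ
  have hP := quadratic_cos_sin_pos ha hb θ
  have hsc : b ^ 2 * Real.sin θ ^ 2 + b ^ 2 * Real.cos θ ^ 2 = b ^ 2 := by
    rw [← mul_add, Real.sin_sq_add_cos_sq, mul_one]
  have key : √(((b * Real.tan θ) ^ 2 + a ^ 2) * ((b * Real.tan θ) ^ 2 + b ^ 2)) =
      b / Real.cos θ ^ 2 * √(a ^ 2 * Real.cos θ ^ 2 + b ^ 2 * Real.sin θ ^ 2) := by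
    have : ((b * Real.tan θ) ^ 2 + a ^ 2) * ((b * Real.tan θ) ^ 2 + b ^ 2) =
        (b / Real.cos θ ^ 2) ^ 2 * (a ^ 2 * Real.cos θ ^ 2 + b ^ 2 * Real.sin θ ^ 2) := by
      rw [Real.tan_eq_sin_div_cos]
      have e : (b * (Real.sin θ / Real.cos θ)) ^ 2 + b ^ 2 = b ^ 2 / Real.cos θ ^ 2 := by
        rw [eq_div_iff (by positivity)]
        field_simp
        linarith [Real.sin_sq_add_cos_sq θ]
      rw [e]
      field_simp
      ring
    rw [this, Real.sqrt_mul (by positivity), Real.sqrt_sq (by positivity)]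
  simp only [smul_eq_mul]
  rw [key, abs_of_pos (by positivity)]
  have := Real.sqrt_pos.2 hP
  field_simp

/-- Gauss's transformation, obtained from the substitution `u = (t - ab / t) / 2`. -/
theorem integral_line_eq_gm_am {a b : ℝ} (ha : 0 < a) (hb : 0 < b) :
    ∫ u : ℝ, (√((u ^ 2 + √(a * b) ^ 2) * (u ^ 2 + ((a + b) / 2) ^ 2)))⁻¹ =
      ∫ t : ℝ, (√((t ^ 2 + a ^ 2) * (t ^ 2 + b ^ 2)))⁻¹ := by
  have hab : 0 < a * b := mul_pos ha hb
  have hder : ∀ t ∈ Ioi (0 : ℝ), HasDerivWithinAt (fun t => (t - a * b / t) / 2)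
      ((1 + a * b / t ^ 2) / 2) (Ioi 0) t := by
    intro t ht
    have ht' : t ≠ 0 := (mem_Ioi.1 ht).ne'
    have := (((hasDerivAt_id t).sub ((hasDerivAt_inv ht').const_mul (a * b))).div_const 2)
    refine HasDerivAt.hasDerivWithinAt (this.congr_deriv ?_)
    field_simp
    ring
  have hmono : StrictMonoOn (fun t : ℝ => (t - a * b / t) / 2) (Ioi 0) := by
    intro s hs t ht hst
    have : a * b / t < a * b / s := div_lt_div_of_pos_left hab hs hst
    simp only
    linarith
  have himg : (fun t : ℝ => (t - a * b / t) / 2) '' Ioi 0 = univ := by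
    refine eq_univ_of_forall fun u => ?_
    have hlt : |u| < √(u ^ 2 + a * b) := by
      rw [← Real.sqrt_sq_eq_abs]; exact Real.sqrt_lt_sqrt (sq_nonneg u) (by linarith)
    have hpos : 0 < u + √(u ^ 2 + a * b) := by linarith [neg_abs_le u]
    refine ⟨u + √(u ^ 2 + a * b), hpos, ?_⟩
    have hs := Real.sq_sqrt (show 0 ≤ u ^ 2 + a * b by positivity)
    simp only
    field_simp
    linarith
  have h2 := integral_image_eq_integral_abs_deriv_smul measurableSet_Ioi hder hmono.injOn
    (fun u : ℝ => (√((u ^ 2 + √(a * b) ^ 2) * (u ^ 2 + ((a + b) / 2) ^ 2)))⁻¹)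
  rw [himg, setIntegral_univ] at h2
  have h3 := integral_comp_abs (f := fun t : ℝ => (√((t ^ 2 + a ^ 2) * (t ^ 2 + b ^ 2)))⁻¹)
  simp only [sq_abs] at h3
  rw [h2, h3, ← integral_const_mul]
  refine setIntegral_congr_fun measurableSet_Ioi fun t ht => ?_
  have ht : 0 < t := ht
  have key : √((((t - a * b / t) / 2) ^ 2 + √(a * b) ^ 2) *
      (((t - a * b / t) / 2) ^ 2 + ((a + b) / 2) ^ 2)) =
      (t ^ 2 + a * b) / (4 * t ^ 2) * √((t ^ 2 + a ^ 2) * (t ^ 2 + b ^ 2)) := by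
    have : (((t - a * b / t) / 2) ^ 2 + √(a * b) ^ 2) *
        (((t - a * b / t) / 2) ^ 2 + ((a + b) / 2) ^ 2) =
        ((t ^ 2 + a * b) / (4 * t ^ 2)) ^ 2 * ((t ^ 2 + a ^ 2) * (t ^ 2 + b ^ 2)) := by
      rw [Real.sq_sqrt hab.le]
      field_simp
      ring
    rw [this, Real.sqrt_mul (by positivity), Real.sqrt_sq (by positivity)]
  simp only [smul_eq_mul]
  rw [key, abs_of_pos (by positivity)]
  have : 0 < √((t ^ 2 + a ^ 2) * (t ^ 2 + b ^ 2)) := by positivity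
  field_simp
  norm_num

theorem gaussIntegral_gm_am {a b : ℝ} (ha : 0 < a) (hb : 0 < b) :
    gaussIntegral (√(a * b)) ((a + b) / 2) = gaussIntegral a b := by
  rw [gaussIntegral_eq_integral_line ha hb, ← integral_line_eq_gm_am ha hb,
    gaussIntegral_eq_integral_line (by positivity) (by positivity)]

theorem gaussIntegral_mem_Icc {a b : ℝ} (ha : 0 < a) (hab : a ≤ b) :
    gaussIntegral a b ∈ Icc (2 * Real.pi * b⁻¹) (2 * Real.pi * a⁻¹) := by
  have hb : 0 < b := ha.trans_le hab
  have hsq : a ^ 2 ≤ b ^ 2 := by gcongr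
  have hpi : (0 : ℝ) ≤ 2 * Real.pi := by positivity
  have hI := (continuous_gaussIntegrand ha hb).intervalIntegrable (μ := volume) 0 (2 * Real.pi)
  constructor
  · have := intervalIntegral.integral_mono_on (μ := volume) hpi
      (intervalIntegrable_const (c := b⁻¹)) hI fun θ _ => by
        refine inv_anti₀ (Real.sqrt_pos.2 (quadratic_cos_sin_pos ha hb θ)) ?_
        rw [Real.sqrt_le_left hb.le]
        nlinarith [Real.sin_sq_add_cos_sq θ, sq_nonneg (Real.cos θ)]
    simpa [gaussIntegral] using this
  · have := intervalIntegral.integral_mono_on (μ := volume) hpi hI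
      (intervalIntegrable_const (c := a⁻¹)) fun θ _ => by
        refine inv_anti₀ ha ?_
        refine Real.le_sqrt_of_sq_le ?_
        nlinarith [Real.sin_sq_add_cos_sq θ, sq_nonneg (Real.sin θ)]
    simpa [gaussIntegral] using this

/-- Gauss's formula for the arithmetic-geometric mean: the integral is invariant along the
iteration, and it is squeezed between `2π / b` and `2π / a`. -/
theorem gaussIntegral_eq_two_pi_div_agm {x y : ℝ≥0} (hx : 0 < x) (hy : 0 < y) :
    gaussIntegral x y = 2 * Real.pi * (NNReal.agm x y : ℝ)⁻¹ := by
  have hpos : ∀ n, 0 < (NNReal.agmSequences x y n).1 := fun n =>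
    lt_of_lt_of_le (by simp [hx, hy]) (NNReal.agmSequences_fst_monotone (Nat.zero_le n))
  have hpos2 : ∀ n, 0 < (NNReal.agmSequences x y n).2 := fun n =>
    (hpos n).trans_le (NNReal.agmSequences_fst_le_snd n n)
  have step : ∀ {u v : ℝ≥0}, 0 < u → 0 < v →
      gaussIntegral (NNReal.sqrt (u * v) : ℝ≥0) ((u + v) / 2 : ℝ≥0) = gaussIntegral u v := by
    intro u v hu hv
    simpa using gaussIntegral_gm_am (a := u) (b := v) hu hv
  have hinv : ∀ n, gaussIntegral (NNReal.agmSequences x y n).1 (NNReal.agmSequences x y n).2 =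
      gaussIntegral x y := by
    intro n
    induction n with
    | zero => exact step hx hy
    | succ n ih => rw [NNReal.agmSequences_succ', ← ih]; exact step (hpos n) (hpos2 n)
  have hagm : (NNReal.agm x y : ℝ) ≠ 0 := by exact_mod_cast (NNReal.agm_pos hx hy).ne'
  have hmem := fun n => gaussIntegral_mem_Icc (a := (NNReal.agmSequences x y n).1)
    (b := (NNReal.agmSequences x y n).2) (by exact_mod_cast hpos n)
    (by exact_mod_cast NNReal.agmSequences_fst_le_snd n n)
  simp only [hinv] at hmem
  have l1 : Tendsto (fun n => 2 * Real.pi * ((NNReal.agmSequences x y n).1 : ℝ)⁻¹) atTop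
      (𝓝 (2 * Real.pi * (NNReal.agm x y : ℝ)⁻¹)) :=
    ((NNReal.tendsto_coe.2 NNReal.tendsto_agmSequences_fst_agm).inv₀ hagm).const_mul _
  have l2 : Tendsto (fun n => 2 * Real.pi * ((NNReal.agmSequences x y n).2 : ℝ)⁻¹) atTop
      (𝓝 (2 * Real.pi * (NNReal.agm x y : ℝ)⁻¹)) :=
    ((NNReal.tendsto_coe.2 NNReal.tendsto_agmSequences_snd_agm).inv₀ hagm).const_mul _
  exact le_antisymm (ge_of_tendsto' l1 fun n => (hmem n).2) (le_of_tendsto' l2 fun n => (hmem n).1)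

/-! ### The geodesic equation of Sol -/

theorem inv_solMetric (p : Fin 3 → ℝ) :
    (solMetric p)⁻¹ = Matrix.diagonal ![Real.exp (2 * p 2), Real.exp (-2 * p 2), 1] := by
  refine Matrix.inv_eq_right_inv ?_
  rw [solMetric, Matrix.diagonal_mul_diagonal, ← Matrix.diagonal_one]
  congr 1
  funext i
  fin_cases i <;> simp [← Real.exp_add]

theorem metricPartial_solMetric (p : Fin 3 → ℝ) (l i j : Fin 3) :
    metricPartial solMetric p l i j =
      if l = 2 ∧ i = j then ![-2 * Real.exp (-2 * p 2), 2 * Real.exp (2 * p 2), 0] i else 0 := by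
  have hexp : ∀ c : ℝ, fderiv ℝ (fun q : Fin 3 → ℝ => Real.exp (c * q 2)) p (Pi.single l 1) =
      if l = 2 then c * Real.exp (c * p 2) else 0 := by
    intro c
    have h : HasFDerivAt (fun q : Fin 3 → ℝ => q 2)
        (ContinuousLinearMap.proj (R := ℝ) (φ := fun _ : Fin 3 => ℝ) 2) p :=
      (ContinuousLinearMap.proj (R := ℝ) (φ := fun _ : Fin 3 => ℝ) 2).hasFDerivAt
    rw [(h.const_mul c).exp.fderiv]
    split_ifs with hl
    · subst hl; simp [mul_comm]
    · simp [Pi.single_eq_of_ne (Ne.symm hl)]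
  unfold metricPartial
  rcases eq_or_ne i j with rfl | hij
  · simp only [solMetric, Matrix.diagonal_apply_eq, and_true]
    fin_cases i
    · simpa using hexp (-2)
    · simpa using hexp 2
    · simp
  · simp [solMetric, hij]

/-- The quadratic form in the velocity that enters the geodesic equation of Sol. -/
theorem sum_christoffel_solMetric (p v : Fin 3 → ℝ) (k : Fin 3) :
    ∑ i, ∑ j, christoffel solMetric p k i j * v i * v j =
      ![-2 * v 0 * v 2, 2 * v 1 * v 2,
        Real.exp (-2 * p 2) * v 0 ^ 2 - Real.exp (2 * p 2) * v 1 ^ 2] k := by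
  have h : Real.exp (2 * p 2) * Real.exp (-(2 * p 2)) = 1 := by
    rw [← Real.exp_add]; simp
  have h20 : (2 : Fin 3) ≠ 0 := by decide
  have h21 : (2 : Fin 3) ≠ 1 := by decide
  fin_cases k <;>
    simp [christoffel, inv_solMetric, metricPartial_solMetric, Fin.sum_univ_three,
      Matrix.diagonal_apply, h20, h21]
  · linear_combination (-2 * v 0 * v 2) * h
  · linear_combination (2 * v 1 * v 2) * h
  · ring

theorem isRiemannianGeodesic_solMetric_iff {γ : ℝ → Fin 3 → ℝ} :
    IsRiemannianGeodesic solMetric γ ↔ ContDiff ℝ 2 γ ∧ ∀ t,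
      deriv (deriv γ) t 0 = 2 * deriv γ t 0 * deriv γ t 2 ∧
      deriv (deriv γ) t 1 = -2 * deriv γ t 1 * deriv γ t 2 ∧
      deriv (deriv γ) t 2 = Real.exp (2 * γ t 2) * deriv γ t 1 ^ 2 -
        Real.exp (-2 * γ t 2) * deriv γ t 0 ^ 2 := by
  unfold IsRiemannianGeodesic
  refine and_congr_right fun _ => forall_congr' fun t => ?_
  simp only [sum_christoffel_solMetric, Fin.forall_fin_succ, IsEmpty.forall_iff, and_true]
  simp only [Matrix.cons_val, Fin.succ_zero_eq_one, Fin.succ_one_eq_two]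
  refine and_congr ?_ (and_congr ?_ ?_) <;> constructor <;> intro h <;> linarith

/-! ### Reduction of geodesics to the height equation -/

/-- A solution of `z'' = b² e^{-2z} - a² e^{2z}`, the equation of motion of the height along a
geodesic of Sol with conserved momenta `a` and `b`, written as a first-order system for the
height `z` and its velocity `v = z'`. -/
structure IsSolHeight (a b : ℝ) (z v : ℝ → ℝ) : Prop where
  hasDerivAt_height : ∀ t, HasDerivAt z (v t) t
  hasDerivAt_velocity : ∀ t, HasDerivAt v
    (b ^ 2 * Real.exp (-2 * z t) - a ^ 2 * Real.exp (2 * z t)) t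

/-- Uniqueness of the height for given initial data. -/
theorem IsSolHeight.eqOn_Icc {a b : ℝ} {z v z' v' : ℝ → ℝ} (h : IsSolHeight a b z v)
    (h' : IsSolHeight a b z' v') (hz : z 0 = z' 0) (hv : v 0 = v' 0) :
    EqOn z z' (Icc 0 1) := by
  let X : ℝ × ℝ → ℝ × ℝ := fun p =>
    (p.2, b ^ 2 * Real.exp (-2 * p.1) - a ^ 2 * Real.exp (2 * p.1))
  have hX : ContDiff ℝ 1 X := by fun_prop
  have hd : ∀ t, HasDerivAt (fun t => (z t, v t)) (X (z t, v t)) t := fun t =>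
    (h.1 t).prodMk (h.2 t)
  have hd' : ∀ t, HasDerivAt (fun t => (z' t, v' t)) (X (z' t, v' t)) t := fun t =>
    (h'.1 t).prodMk (h'.2 t)
  have hc : Continuous fun t => (z t, v t) :=
    continuous_iff_continuousAt.2 fun t => (hd t).continuousAt
  have hc' : Continuous fun t => (z' t, v' t) :=
    continuous_iff_continuousAt.2 fun t => (hd' t).continuousAt
  -- On `[0, 1]` both trajectories stay in a compact set, where the smooth field is Lipschitz.
  let S : Set (ℝ × ℝ) := (fun t => (z t, v t)) '' Icc 0 1 ∪ (fun t => (z' t, v' t)) '' Icc 0 1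
  have hS : IsCompact S := (isCompact_Icc.image hc).union (isCompact_Icc.image hc')
  obtain ⟨K, hK⟩ := LocallyLipschitzOn.exists_lipschitzOnWith_of_compact hS
    (hX.locallyLipschitz.locallyLipschitzOn (s := S))
  have := ODE_solution_unique_of_mem_Icc_right (v := fun _ => X) (s := fun _ => S) (K := K)
    (a := 0) (b := 1) (fun _ _ => hK) hc.continuousOn (fun t _ => (hd t).hasDerivWithinAt)
    (fun t ht => Or.inl ⟨t, Ico_subset_Icc_self ht, rfl⟩) hc'.continuousOn
    (fun t _ => (hd' t).hasDerivWithinAt)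
    (fun t ht => Or.inr ⟨t, Ico_subset_Icc_self ht, rfl⟩) (by simp [hz, hv])
  exact fun t ht => congrArg Prod.fst (this ht)

/-- Invariance of the metric under translations of `x` and `y` makes `e^{-2z} x'` and `e^{2z} y'`
constant along geodesics. -/
theorem IsRiemannianGeodesic.hasDerivAt_horizontal {γ : ℝ → Fin 3 → ℝ} {V : Fin 3 → ℝ}
    (h : IsRiemannianGeodesic solMetric γ) (h0 : γ 0 = 0) (hV : deriv γ 0 = V) :
    (∀ t, HasDerivAt (fun t => γ t 0) (V 0 * Real.exp (2 * γ t 2)) t) ∧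
    (∀ t, HasDerivAt (fun t => γ t 1) (V 1 * Real.exp (-2 * γ t 2)) t) ∧
    IsSolHeight (V 0) (V 1) (fun t => γ t 2) (fun t => deriv γ t 2) := by
  obtain ⟨hC, hγ⟩ := isRiemannianGeodesic_solMetric_iff.1 h
  have hd : ∀ i t, HasDerivAt (fun t => γ t i) (deriv γ t i) t := fun i t =>
    hasDerivAt_pi.1 ((hC.differentiable (by norm_num)) t).hasDerivAt i
  have hC1 : ContDiff ℝ 1 (deriv γ) := by
    have := (contDiff_succ_iff_deriv (n := 1)).1 (by simpa [one_add_one_eq_two] using hC)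
    exact this.2.2
  have hdd : ∀ i t, HasDerivAt (fun t => deriv γ t i) (deriv (deriv γ) t i) t := fun i t =>
    hasDerivAt_pi.1 ((hC1.differentiable (by norm_num)) t).hasDerivAt i
  have hconst : ∀ {f : ℝ → ℝ}, (∀ t, HasDerivAt f 0 t) → ∀ t, f t = f 0 := fun hf t =>
    is_const_of_deriv_eq_zero (fun t => (hf t).differentiableAt) (fun t => (hf t).deriv) t 0
  have hx : ∀ t, deriv γ t 0 * Real.exp (-2 * γ t 2) = V 0 := by
    intro t
    rw [hconst (f := fun t => deriv γ t 0 * Real.exp (-2 * γ t 2)) (fun t => ?_) t]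
    · simp [h0, hV]
    · refine ((hdd 0 t).mul ((hd 2 t).const_mul (-2)).exp).congr_deriv ?_
      rw [(hγ t).1]; ring
  have hy : ∀ t, deriv γ t 1 * Real.exp (2 * γ t 2) = V 1 := by
    intro t
    rw [hconst (f := fun t => deriv γ t 1 * Real.exp (2 * γ t 2)) (fun t => ?_) t]
    · simp [h0, hV]
    · refine ((hdd 1 t).mul ((hd 2 t).const_mul 2).exp).congr_deriv ?_
      rw [(hγ t).2.1]; ring
  have he : ∀ t, Real.exp (-2 * γ t 2) * Real.exp (2 * γ t 2) = 1 := fun t => by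
    rw [← Real.exp_add]; simp
  refine ⟨fun t => (hd 0 t).congr_deriv ?_, fun t => (hd 1 t).congr_deriv ?_, hd 2,
    fun t => (hdd 2 t).congr_deriv ?_⟩
  · rw [← hx t, mul_assoc, he, mul_one]
  · rw [← hy t, mul_assoc, mul_comm (Real.exp _), he, mul_one]
  · rw [(hγ t).2.2, ← hx t, ← hy t]
    linear_combination (-Real.exp (2 * γ t 2) * deriv γ t 1 ^ 2 +
      Real.exp (-2 * γ t 2) * deriv γ t 0 ^ 2) * he t

/-- Conversely, every height function lifts to a geodesic. -/
theorem IsSolHeight.exists_geodesic {V : Fin 3 → ℝ} {z v : ℝ → ℝ}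
    (h : IsSolHeight (V 0) (V 1) z v) (hz : z 0 = 0) (hv : v 0 = V 2) :
    ∃ γ : ℝ → Fin 3 → ℝ, IsRiemannianGeodesic solMetric γ ∧ γ 0 = 0 ∧ deriv γ 0 = V := by
  have hzc : Continuous z := continuous_iff_continuousAt.2 fun t => (h.1 t).continuousAt
  have hvc : Continuous v := continuous_iff_continuousAt.2 fun t => (h.2 t).continuousAt
  have hx : ∀ t, HasDerivAt (fun t => ∫ s in (0)..t, V 0 * Real.exp (2 * z s))
      (V 0 * Real.exp (2 * z t)) t := fun t =>
    Continuous.integral_hasStrictDerivAt (by fun_prop) 0 t |>.hasDerivAt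
  have hy : ∀ t, HasDerivAt (fun t => ∫ s in (0)..t, V 1 * Real.exp (-2 * z s))
      (V 1 * Real.exp (-2 * z t)) t := fun t =>
    Continuous.integral_hasStrictDerivAt (by fun_prop) 0 t |>.hasDerivAt
  let γ : ℝ → Fin 3 → ℝ := fun t => ![∫ s in (0)..t, V 0 * Real.exp (2 * z s),
    ∫ s in (0)..t, V 1 * Real.exp (-2 * z s), z t]
  let γ' : ℝ → Fin 3 → ℝ := fun t => ![V 0 * Real.exp (2 * z t), V 1 * Real.exp (-2 * z t), v t]
  let γ'' : ℝ → Fin 3 → ℝ := fun t => ![V 0 * (Real.exp (2 * z t) * (2 * v t)),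
    V 1 * (Real.exp (-2 * z t) * (-2 * v t)),
    V 1 ^ 2 * Real.exp (-2 * z t) - V 0 ^ 2 * Real.exp (2 * z t)]
  have h1 : ∀ t, HasDerivAt γ (γ' t) t := fun t => by
    refine hasDerivAt_pi.2 fun i => ?_
    fin_cases i
    · exact hx t
    · exact hy t
    · exact h.1 t
  have h2 : ∀ t, HasDerivAt γ' (γ'' t) t := fun t => by
    refine hasDerivAt_pi.2 fun i => ?_
    fin_cases i
    · exact (((h.1 t).const_mul 2).exp).const_mul (V 0)
    · exact (((h.1 t).const_mul (-2)).exp).const_mul (V 1)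
    · exact h.2 t
  have e1 : deriv γ = γ' := funext fun t => (h1 t).deriv
  have e2 : deriv γ' = γ'' := funext fun t => (h2 t).deriv
  have hcont : Continuous γ'' := by
    refine continuous_pi fun i => ?_
    fin_cases i <;> simp [γ''] <;> fun_prop
  have he : ∀ t, Real.exp (-2 * z t) * Real.exp (2 * z t) = 1 := fun t => by
    rw [← Real.exp_add]; simp
  refine ⟨γ, isRiemannianGeodesic_solMetric_iff.2 ⟨?_, fun t => ?_⟩, ?_, ?_⟩
  · have : ContDiff ℝ (1 + 1) γ := by
      refine contDiff_succ_iff_deriv.2 ⟨fun t => (h1 t).differentiableAt, by simp, ?_⟩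
      rw [e1]
      exact contDiff_one_iff_deriv.2 ⟨fun t => (h2 t).differentiableAt, by rwa [e2]⟩
    simpa [one_add_one_eq_two] using this
  · rw [e1, e2]
    simp only [γ, γ', γ'', Matrix.cons_val]
    refine ⟨by ring, by ring, ?_⟩
    linear_combination (V 0 ^ 2 * Real.exp (2 * z t) - V 1 ^ 2 * Real.exp (-2 * z t)) * he t
  · funext i; fin_cases i <;> simp [γ, hz]
  · rw [e1]; funext i; fin_cases i <;> simp [γ', hz, hv]

/-- The horizontal coordinates of the exponential map in terms of any solution of the height
equation with the right initial data. -/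
theorem IsSolHeight.solExp_eq {V : Fin 3 → ℝ} {z v : ℝ → ℝ}
    (h : IsSolHeight (V 0) (V 1) z v) (hz : z 0 = 0) (hv : v 0 = V 2) :
    solExp V 0 = V 0 * ∫ t in (0)..1, Real.exp (2 * z t) ∧
    solExp V 1 = V 1 * ∫ t in (0)..1, Real.exp (-2 * z t) := by
  have hex := h.exists_geodesic hz hv
  have hE : solExp V = hex.choose 1 := by
    unfold solExp riemannianExp
    exact dif_pos hex
  obtain ⟨hg, h0, hV⟩ := hex.choose_spec
  rw [hE]
  set γ := hex.choose
  obtain ⟨hx, hy, hh⟩ := hg.hasDerivAt_horizontal h0 hV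
  have heq : EqOn (fun t => γ t 2) z (Icc 0 1) :=
    hh.eqOn_Icc h (by simp [h0, hz]) (by simp [hV, hv])
  have hc : Continuous fun t => γ t 2 :=
    continuous_iff_continuousAt.2 fun t => (hh.1 t).continuousAt
  have key : ∀ (i : Fin 3) (c d : ℝ),
      (∀ t, HasDerivAt (fun t => γ t i) (c * Real.exp (d * γ t 2)) t) →
      γ 1 i = c * ∫ t in (0)..1, Real.exp (d * z t) := by
    intro i c d hi
    have := intervalIntegral.integral_eq_sub_of_hasDerivAt (a := 0) (b := 1) (fun t _ => hi t)
      (Continuous.intervalIntegrable (by fun_prop) _ _)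
    simp only [h0, Pi.zero_apply, sub_zero] at this
    rw [← this, intervalIntegral.integral_const_mul]
    congr 1
    refine intervalIntegral.integral_congr fun t ht => ?_
    rw [uIcc_of_le zero_le_one] at ht
    simp only [← heq ht]
  exact ⟨key 0 _ _ hx, key 1 _ _ hy⟩

/-! ### Separation of variables -/

/-- Separation of variables: the solution of `θ' = 1 / r(θ)` with `θ(0) = θ₀`, as the inverse of
`s ↦ ∫_{θ₀}^s r`. -/
theorem exists_hasDerivAt_inv_comp {r : ℝ → ℝ} (hr : Continuous r) {δ : ℝ} (hδ : 0 < δ)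
    (hδr : ∀ s, δ ≤ r s) (θ₀ : ℝ) :
    ∃ θ : ℝ → ℝ, (∀ t, HasDerivAt θ (r (θ t))⁻¹ t) ∧ ∀ s, θ (∫ u in θ₀..s, r u) = s := by
  let τ : ℝ → ℝ := fun s => ∫ u in θ₀..s, r u
  have hτ : ∀ s, HasDerivAt τ (r s) s := fun s => (hr.integral_hasStrictDerivAt θ₀ s).hasDerivAt
  have hpos : ∀ s, 0 < r s := fun s => hδ.trans_le (hδr s)
  have hmono : StrictMono τ := strictMono_of_deriv_pos fun s => by rw [(hτ s).deriv]; exact hpos s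
  have hcont : Continuous τ := continuous_iff_continuousAt.2 fun s => (hτ s).continuousAt
  have hgrow : Monotone fun s => τ s - δ * s := by
    have hd : ∀ s, HasDerivAt (fun s => τ s - δ * s) (r s - δ * 1) s := fun s =>
      (hτ s).sub ((hasDerivAt_id s).const_mul δ)
    refine monotone_of_deriv_nonneg (fun s => (hd s).differentiableAt) fun s => ?_
    rw [(hd s).deriv]
    linarith [hδr s]
  have htop : Tendsto τ atTop atTop := by
    refine tendsto_atTop_mono' atTop ?_
      (tendsto_atTop_add_const_left _ (τ 0) (tendsto_id.const_mul_atTop hδ))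
    filter_upwards [eventually_ge_atTop 0] with s hs
    have := hgrow hs
    simp only [mul_zero, sub_zero] at this
    simp only [id]; linarith
  have hbot : Tendsto τ atBot atBot := by
    refine tendsto_atBot_mono' atBot ?_
      (tendsto_atBot_add_const_left _ (τ 0) (tendsto_id.const_mul_atBot hδ))
    filter_upwards [eventually_le_atBot 0] with s hs
    have := hgrow hs
    simp only [mul_zero, sub_zero] at this
    simp only [id]; linarith
  let e := hmono.orderIsoOfSurjective τ (hcont.surjective htop hbot)
  refine ⟨e.symm, fun t => ?_, fun s => e.symm_apply_apply s⟩
  exact HasDerivAt.of_local_left_inverse e.symm.continuous.continuousAt (hτ _) (hpos _).ne'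
    (Eventually.of_forall fun y => e.apply_symm_apply y)

/-! ### The period and holonomy integrals -/

/-- The complete elliptic integral `∫₀^{2π} dθ / √(1 + A² sin² θ)`, which is `2 α` times the period
of `w'² = 4 α² (A² - sinh² w)`. -/
noncomputable def ellipticPeriod (A : ℝ) : ℝ :=
  ∫ θ in (0)..(2 * Real.pi), (√(1 + (A * Real.sin θ) ^ 2))⁻¹

/-- The integral `∫₀^{2π} (1 + 2 A² sin² θ) / √(1 + A² sin² θ) dθ`, which is `2 α` times the
integral of `cosh 2w` over one period of `w'² = 4 α² (A² - sinh² w)`. -/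
noncomputable def ellipticHolonomy (A : ℝ) : ℝ :=
  ∫ θ in (0)..(2 * Real.pi), (1 + 2 * (A * Real.sin θ) ^ 2) / √(1 + (A * Real.sin θ) ^ 2)

theorem sqrt_one_add_sq_pos (x : ℝ) : 0 < √(1 + x ^ 2) := by positivity

theorem continuous_inv_sqrt_one_add (A : ℝ) :
    Continuous fun θ : ℝ => (√(1 + (A * Real.sin θ) ^ 2))⁻¹ :=
  Continuous.inv₀ (by fun_prop) fun _ => (sqrt_one_add_sq_pos _).ne'

theorem continuous_ellipticHolonomy_integrand (A : ℝ) : Continuous fun θ : ℝ =>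
    (1 + 2 * (A * Real.sin θ) ^ 2) / √(1 + (A * Real.sin θ) ^ 2) :=
  Continuous.div (by fun_prop) (by fun_prop) fun _ => (sqrt_one_add_sq_pos _).ne'

theorem gaussIntegral_mul_sqrt_one_add {α A : ℝ} (hα : 0 < α) :
    gaussIntegral α (α * √(1 + A ^ 2)) = α⁻¹ * ellipticPeriod A := by
  rw [gaussIntegral, ellipticPeriod, ← intervalIntegral.integral_const_mul]
  congr 1
  funext θ
  have : α ^ 2 * Real.cos θ ^ 2 + (α * √(1 + A ^ 2)) ^ 2 * Real.sin θ ^ 2 =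
      α ^ 2 * (1 + (A * Real.sin θ) ^ 2) := by
    rw [mul_pow α, Real.sq_sqrt (by positivity)]
    linear_combination α ^ 2 * Real.sin_sq_add_cos_sq θ
  rw [this, Real.sqrt_mul (sq_nonneg α), Real.sqrt_sq hα.le, mul_inv]

theorem div_sqrt_one_add_strictMonoOn :
    StrictMonoOn (fun u : ℝ => (1 + 2 * u) / √(1 + u)) (Ici 0) := by
  have h : ∀ u : ℝ, 0 ≤ u → (1 + 2 * u) / √(1 + u) = 2 * √(1 + u) - (√(1 + u))⁻¹ := by
    intro u hu
    have hs := Real.sq_sqrt (show 0 ≤ 1 + u by linarith)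
    have : 0 < √(1 + u) := Real.sqrt_pos.2 (by linarith)
    field_simp
    linarith
  intro u hu v hv huv
  have hu : 0 ≤ u := hu
  simp only
  rw [h u hu, h v hv]
  have h1 : √(1 + u) < √(1 + v) := Real.sqrt_lt_sqrt (by linarith) (by linarith)
  have h2 : (√(1 + v))⁻¹ < (√(1 + u))⁻¹ :=
    inv_strictAnti₀ (Real.sqrt_pos.2 (by linarith)) h1
  linarith

theorem ellipticHolonomy_strictMonoOn : StrictMonoOn ellipticHolonomy (Ici 0) := by
  intro A hA B hB hAB
  have hA : 0 ≤ A := hA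
  have hpi := Real.pi_pos
  have hsq : ∀ θ, (A * Real.sin θ) ^ 2 ≤ (B * Real.sin θ) ^ 2 := fun θ => by
    rw [mul_pow, mul_pow]; gcongr
  refine intervalIntegral.integral_lt_integral_of_continuousOn_of_le_of_exists_lt
    (by positivity) (continuous_ellipticHolonomy_integrand A).continuousOn
    (continuous_ellipticHolonomy_integrand B).continuousOn
    (fun θ _ => div_sqrt_one_add_strictMonoOn.monotoneOn (mem_Ici.2 (sq_nonneg _))
      (mem_Ici.2 (sq_nonneg _)) (hsq θ))
    ⟨Real.pi / 2, ⟨by positivity, by linarith⟩, ?_⟩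
  refine div_sqrt_one_add_strictMonoOn (mem_Ici.2 (sq_nonneg _)) (mem_Ici.2 (sq_nonneg _)) ?_
  simp only [Real.sin_pi_div_two, mul_one]
  gcongr

theorem ellipticHolonomy_pos (A : ℝ) : 0 < ellipticHolonomy A :=
  intervalIntegral.intervalIntegral_pos_of_pos
    ((continuous_ellipticHolonomy_integrand A).intervalIntegrable _ _)
    (fun _ => by positivity) (by positivity)

/-- The integral of `e^{2σw}` with `sinh w = A sin θ` over a period; the part coming from
`sinh 2w` integrates to zero. -/
theorem integral_sq_div_sqrt_one_add (A σ θ₀ : ℝ) (hσ : σ ^ 2 = 1) :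
    ∫ θ in θ₀..(θ₀ + 2 * Real.pi),
      (σ * (A * Real.sin θ) + √(1 + (A * Real.sin θ) ^ 2)) ^ 2 *
        (√(1 + (A * Real.sin θ) ^ 2))⁻¹ = ellipticHolonomy A := by
  have hper : Function.Periodic (fun θ => (σ * (A * Real.sin θ) +
      √(1 + (A * Real.sin θ) ^ 2)) ^ 2 * (√(1 + (A * Real.sin θ) ^ 2))⁻¹) (2 * Real.pi) := by
    intro θ; simp [Real.sin_add_two_pi]
  rw [hper.intervalIntegral_add_eq θ₀ 0, zero_add]
  have : ∀ θ, (σ * (A * Real.sin θ) + √(1 + (A * Real.sin θ) ^ 2)) ^ 2 *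
      (√(1 + (A * Real.sin θ) ^ 2))⁻¹ = (1 + 2 * (A * Real.sin θ) ^ 2) /
        √(1 + (A * Real.sin θ) ^ 2) + 2 * σ * A * Real.sin θ := by
    intro θ
    have hs := Real.sq_sqrt (show 0 ≤ 1 + (A * Real.sin θ) ^ 2 by positivity)
    have hp := sqrt_one_add_sq_pos (A * Real.sin θ)
    rw [mul_assoc (2 * σ)]
    generalize A * Real.sin θ = x at hs hp ⊢
    field_simp
    linear_combination x ^ 2 * hσ + hs
  simp only [this]
  rw [intervalIntegral.integral_add
    ((continuous_ellipticHolonomy_integrand A).intervalIntegrable _ _)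
    (Continuous.intervalIntegrable (by fun_prop) _ _), intervalIntegral.integral_const_mul]
  simp [ellipticHolonomy]

/-! ### The exponential map at vectors of period one -/

/-- The amplitude `A` in the parametrization `sinh w = A sin θ` of the shifted height
`w = z + ½ log (x / y)` along the geodesic with initial velocity `V = (x, y, ·)`. It is meaningful
only for `x, y > 0`; for `x y ≤ 0` the denominator is `0`, and so is the value. -/
noncomputable def solAmplitude (V : Fin 3 → ℝ) : ℝ :=
  √((V 0 - V 1) ^ 2 + V 2 ^ 2) / (2 * √(V 0 * V 1))

/-- Polar coordinates of `(x, y)`; any phase serves at the origin. -/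
theorem exists_phase (x y : ℝ) :
    ∃ θ, √(y ^ 2 + x ^ 2) * Real.sin θ = y ∧ √(y ^ 2 + x ^ 2) * Real.cos θ = x := by
  have h : ‖(⟨x, y⟩ : ℂ)‖ = √(y ^ 2 + x ^ 2) := by
    rw [Complex.norm_def, Complex.normSq_mk]; ring_nf
  refine ⟨Complex.arg ⟨x, y⟩, ?_, ?_⟩
  · rw [← h, Complex.norm_mul_sin_arg]
  · rw [← h, Complex.norm_mul_cos_arg]

/-- If the height oscillates with period `1`, the exponential map is given by a complete elliptic
integral of the amplitude, and the roles of the two horizontal coordinates are exchanged. -/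
theorem solExp_of_ellipticPeriod_eq {V : Fin 3 → ℝ} (h0 : 0 < V 0) (h1 : 0 < V 1)
    (hT : ellipticPeriod (solAmplitude V) = 2 * √(V 0 * V 1)) :
    solExp V 0 = V 1 / (2 * √(V 0 * V 1)) * ellipticHolonomy (solAmplitude V) ∧
    solExp V 1 = V 0 / (2 * √(V 0 * V 1)) * ellipticHolonomy (solAmplitude V) := by
  set a := V 0
  set b := V 1
  set A := solAmplitude V with hA
  set α := √(a * b) with hα
  have hαpos : 0 < α := Real.sqrt_pos.2 (mul_pos h0 h1)
  have hα2 : α ^ 2 = a * b := Real.sq_sqrt (mul_pos h0 h1).le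
  have hαA : 2 * α * A = √((a - b) ^ 2 + V 2 ^ 2) := by
    change 2 * α * (√((a - b) ^ 2 + V 2 ^ 2) / (2 * α)) = _
    field_simp
  -- The initial phase is prescribed by `w(0) = ½ log (a / b)`, i.e. `2 α sinh w(0) = a - b`, and by
  -- `w'(0) = 2 α A cos θ₀ = V 2`.
  obtain ⟨θ₀, hs, hc⟩ := exists_phase (V 2) (a - b)
  rw [← hαA] at hs hc
  have hRle : ∀ s, √(1 + (A * Real.sin s) ^ 2) ≤ √(1 + A ^ 2) := fun s => by
    refine Real.sqrt_le_sqrt ?_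
    rw [mul_pow]
    nlinarith [Real.sin_sq_le_one s, sq_nonneg A]
  have hrc : Continuous fun s => (2 * α * √(1 + (A * Real.sin s) ^ 2))⁻¹ :=
    Continuous.inv₀ (by fun_prop) fun s => by positivity
  obtain ⟨θ, hθ, hθs⟩ := exists_hasDerivAt_inv_comp hrc (δ := (2 * α * √(1 + A ^ 2))⁻¹)
    (by positivity) (fun s => inv_anti₀ (by positivity) (by gcongr ?_ * ?_; exact hRle s)) θ₀
  simp only [inv_inv] at hθ
  have hθ0 : θ 0 = θ₀ := by simpa using hθs θ₀
  -- The hypothesis on the period says that one unit of time is a full turn of the phase.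
  have hθ1 : θ 1 = θ₀ + 2 * Real.pi := by
    rw [← hθs (θ₀ + 2 * Real.pi)]
    congr 1
    have hper : Function.Periodic (fun s => (√(1 + (A * Real.sin s) ^ 2))⁻¹) (2 * Real.pi) := by
      intro s; simp [Real.sin_add_two_pi]
    simp only [mul_inv (2 * α)]
    rw [intervalIntegral.integral_const_mul, hper.intervalIntegral_add_eq θ₀ 0, zero_add]
    change 1 = (2 * α)⁻¹ * ellipticPeriod A
    rw [hT]; field_simp
  have hθc : Continuous θ := continuous_iff_continuousAt.2 fun t => (hθ t).continuousAt
  let S : ℝ → ℝ := fun t => A * Real.sin (θ t)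
  let w : ℝ → ℝ := fun t => Real.arsinh (S t)
  have hS : ∀ t, HasDerivAt S (A * (Real.cos (θ t) * (2 * α * √(1 + S t ^ 2)))) t := fun t =>
    ((hθ t).sin).const_mul A
  have hw : ∀ t, HasDerivAt w (2 * α * A * Real.cos (θ t)) t := fun t => by
    refine (hS t).arsinh.congr_deriv ?_
    have := sqrt_one_add_sq_pos (S t)
    rw [smul_eq_mul]; field_simp
  have hexp : ∀ t, Real.exp (w t) = S t + √(1 + S t ^ 2) := fun t => Real.exp_arsinh _
  have hexpn : ∀ t, Real.exp (-w t) = -S t + √(1 + S t ^ 2) := fun t => by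
    simp only [w]
    rw [← Real.arsinh_neg, Real.exp_arsinh, neg_sq]
  have hprod : ∀ t, Real.exp (w t) * Real.exp (-w t) = 1 := fun t => by
    rw [← Real.exp_add]; simp
  have hS0 : 2 * α * S 0 = a - b := by simp only [S, hθ0]; rw [← hs]; ring
  have hR0 : 2 * α * √(1 + S 0 ^ 2) = a + b := by
    have : (2 * α) ^ 2 * (1 + S 0 ^ 2) = (a + b) ^ 2 := by
      linear_combination 4 * hα2 + (2 * α * S 0 + (a - b)) * hS0
    rw [← Real.sqrt_sq (show 0 ≤ 2 * α by positivity), ← Real.sqrt_mul (sq_nonneg _), this,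
      Real.sqrt_sq (by positivity)]
  have ha0 : α * Real.exp (w 0) = a := by rw [hexp]; linarith
  have hb0 : α * Real.exp (-w 0) = b := by rw [hexpn]; linarith
  have hsplit : ∀ t, Real.exp (2 * (w t - w 0)) = (Real.exp (w t) * Real.exp (-w 0)) ^ 2 ∧
      Real.exp (-2 * (w t - w 0)) = (Real.exp (-w t) * Real.exp (w 0)) ^ 2 := fun t => by
    constructor <;> (rw [← Real.exp_add, ← Real.exp_nat_mul]; push_cast; ring_nf)
  have hheight : IsSolHeight (V 0) (V 1) (fun t => w t - w 0)
      (fun t => 2 * α * A * Real.cos (θ t)) := by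
    refine ⟨fun t => (hw t).sub_const _, fun t => ?_⟩
    refine (((hθ t).cos).const_mul (2 * α * A)).congr_deriv ?_
    rw [(hsplit t).1, (hsplit t).2]
    have e1 : V 1 * Real.exp (w 0) = α := by
      change b * _ = α
      rw [← hb0]; linear_combination α * hprod 0
    have e2 : V 0 * Real.exp (-w 0) = α := by
      change a * _ = α
      rw [← ha0]; linear_combination α * hprod 0
    calc _ = -(4 * α ^ 2 * S t * √(1 + S t ^ 2)) := by simp only [S]; ring
      _ = (α * Real.exp (-w t)) ^ 2 - (α * Real.exp (w t)) ^ 2 := by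
        rw [hexp, hexpn]; ring
      _ = (V 1 * Real.exp (w 0) * Real.exp (-w t)) ^ 2 -
          (V 0 * Real.exp (-w 0) * Real.exp (w t)) ^ 2 := by rw [e1, e2]
      _ = _ := by ring
  obtain ⟨hx, hy⟩ := hheight.solExp_eq (by simp) (by simp only [hθ0]; exact hc)
  -- `σ = ±1` gives the integrals of `e^{2w}` and of `e^{-2w}`.
  have key : ∀ σ : ℝ, σ ^ 2 = 1 →
      ∫ t in (0)..1, (σ * S t + √(1 + S t ^ 2)) ^ 2 = (2 * α)⁻¹ * ellipticHolonomy A := by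
    intro σ hσ
    have hsub := intervalIntegral.integral_comp_mul_deriv (a := 0) (b := 1) (f := θ)
      (g := fun s => (σ * (A * Real.sin s) + √(1 + (A * Real.sin s) ^ 2)) ^ 2 *
        (√(1 + (A * Real.sin s) ^ 2))⁻¹) (fun t _ => hθ t) (by fun_prop)
      ((by fun_prop : Continuous fun s : ℝ =>
        (σ * (A * Real.sin s) + √(1 + (A * Real.sin s) ^ 2)) ^ 2).mul
        (continuous_inv_sqrt_one_add A))
    rw [hθ0, hθ1, integral_sq_div_sqrt_one_add A σ θ₀ hσ] at hsub
    rw [← hsub, ← intervalIntegral.integral_const_mul]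
    refine intervalIntegral.integral_congr fun t _ => ?_
    have := sqrt_one_add_sq_pos (A * Real.sin (θ t))
    simp only [S, Function.comp_apply]
    field_simp
  have k1 := key 1 (by norm_num)
  have k2 := key (-1) (by norm_num)
  simp only [one_mul, neg_mul, ← hexp, ← hexpn] at k1 k2
  have hbb : b * Real.exp (w 0) ^ 2 = a := by
    rw [← hb0, ← ha0]; linear_combination α * Real.exp (w 0) * hprod 0
  have haa : a * Real.exp (-w 0) ^ 2 = b := by
    rw [← hb0, ← ha0]; linear_combination α * Real.exp (-w 0) * hprod 0
  constructor
  · rw [hx]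
    simp only [(hsplit _).1, mul_pow]
    rw [intervalIntegral.integral_mul_const, k1]
    change a * _ = _
    rw [div_eq_mul_inv]
    linear_combination (2 * α)⁻¹ * ellipticHolonomy A * haa
  · rw [hy]
    simp only [(hsplit _).2, mul_pow]
    rw [intervalIntegral.integral_mul_const, k2]
    change b * _ = _
    rw [div_eq_mul_inv]
    linear_combination (2 * α)⁻¹ * ellipticHolonomy A * hbb

/-! ### Perfect vectors -/

theorem sqrt_mul_sqrt_one_add_solAmplitude_sq {V : Fin 3 → ℝ} (h0 : 0 < V 0) (h1 : 0 < V 1) :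
    √(V 0 * V 1) * √(1 + solAmplitude V ^ 2) = 1 / 2 * √((V 0 + V 1) ^ 2 + V 2 ^ 2) := by
  have hα : 0 < V 0 * V 1 := mul_pos h0 h1
  have : V 0 * V 1 * (1 + solAmplitude V ^ 2) = (1 / 2) ^ 2 * ((V 0 + V 1) ^ 2 + V 2 ^ 2) := by
    rw [solAmplitude, div_pow, mul_pow, Real.sq_sqrt (by positivity), Real.sq_sqrt hα.le]
    field_simp
    ring
  rw [← Real.sqrt_mul hα.le, this, Real.sqrt_mul (by positivity), Real.sqrt_sq (by norm_num)]

/-- A perfect vector in the closed positive octant has positive horizontal components, because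
`AGM(0, ·) = 0`. -/
theorem IsPerfect.pos {V : Fin 3 → ℝ} (hV : IsPerfect V) (hnn : ∀ i, 0 ≤ V i) :
    0 < V 0 ∧ 0 < V 1 := by
  have : V 0 * V 1 ≠ 0 := by
    intro h
    rw [IsPerfect, solMu, h] at hV
    simp [Real.pi_ne_zero.symm] at hV
  exact ⟨(hnn 0).lt_of_ne' (left_ne_zero_of_mul this),
    (hnn 1).lt_of_ne' (right_ne_zero_of_mul this)⟩

/-- By Gauss's formula, the height along the geodesic of a perfect vector oscillates with
period `1`. -/
theorem IsPerfect.ellipticPeriod_eq {V : Fin 3 → ℝ} (hV : IsPerfect V) (h0 : 0 < V 0)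
    (h1 : 0 < V 1) : ellipticPeriod (solAmplitude V) = 2 * √(V 0 * V 1) := by
  have hα : 0 < √(V 0 * V 1) := Real.sqrt_pos.2 (mul_pos h0 h1)
  have hm := sqrt_mul_sqrt_one_add_solAmplitude_sq h0 h1
  have hmpos : 0 < 1 / 2 * √((V 0 + V 1) ^ 2 + V 2 ^ 2) := by positivity
  have hg := gaussIntegral_eq_two_pi_div_agm (Real.toNNReal_pos.2 hα) (Real.toNNReal_pos.2 hmpos)
  rw [IsPerfect, solMu, abs_of_pos (mul_pos h0 h1), abs_of_pos h0, abs_of_pos h1] at hV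
  rw [hV, Real.coe_toNNReal _ hα.le, Real.coe_toNNReal _ hmpos.le, ← hm,
    gaussIntegral_mul_sqrt_one_add hα] at hg
  have hpi := Real.pi_ne_zero
  field_simp at hg
  linarith

theorem corollary2p9 :
    Set.InjOn solExp {V : Fin 3 → ℝ | IsPerfect V ∧ ∀ i : Fin 3, 0 ≤ V i} := by
  rintro V ⟨hV, hVn⟩ W ⟨hW, hWn⟩ hE
  obtain ⟨hV0, hV1⟩ := hV.pos hVn
  obtain ⟨hW0, hW1⟩ := hW.pos hWn
  have hTV := hV.ellipticPeriod_eq hV0 hV1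
  have hTW := hW.ellipticPeriod_eq hW0 hW1
  obtain ⟨hVx, hVy⟩ := solExp_of_ellipticPeriod_eq hV0 hV1 hTV
  obtain ⟨hWx, hWy⟩ := solExp_of_ellipticPeriod_eq hW0 hW1 hTW
  rw [hE, hWx] at hVx
  rw [hE, hWy] at hVy
  have hαV : 0 < √(V 0 * V 1) := Real.sqrt_pos.2 (mul_pos hV0 hV1)
  have hαW : 0 < √(W 0 * W 1) := Real.sqrt_pos.2 (mul_pos hW0 hW1)
  have hFV := ellipticHolonomy_pos (solAmplitude V)
  have hFW := ellipticHolonomy_pos (solAmplitude W)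
  -- The product of the two horizontal coordinates of `E(V)` is a quarter of the squared holonomy.
  have hprod : ∀ {U : Fin 3 → ℝ} {F : ℝ}, 0 < U 0 * U 1 →
      U 1 / (2 * √(U 0 * U 1)) * F * (U 0 / (2 * √(U 0 * U 1)) * F) = F ^ 2 / 4 := by
    intro U F hU
    have h := Real.sq_sqrt hU.le
    calc _ = U 0 * U 1 * F ^ 2 / (4 * √(U 0 * U 1) ^ 2) := by ring
      _ = _ := by rw [h, mul_comm 4 (U 0 * U 1), mul_div_mul_left _ _ hU.ne']
  have hF : ellipticHolonomy (solAmplitude W) = ellipticHolonomy (solAmplitude V) := by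
    have h := hprod (F := ellipticHolonomy (solAmplitude V)) (mul_pos hV0 hV1)
    rw [← hVx, ← hVy, hprod (mul_pos hW0 hW1)] at h
    exact (pow_left_inj₀ hFW.le hFV.le two_ne_zero).1 (by linarith)
  have hA : solAmplitude W = solAmplitude V :=
    ellipticHolonomy_strictMonoOn.injOn (by unfold solAmplitude; exact mem_Ici.2 (by positivity))
      (by unfold solAmplitude; exact mem_Ici.2 (by positivity)) hF
  have hα : √(W 0 * W 1) = √(V 0 * V 1) := by rw [hA] at hTW; linarith
  rw [hF, hα] at hVx hVy
  have e1 : W 1 = V 1 := by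
    have := mul_right_cancel₀ hFV.ne' hVx
    exact (div_left_inj' (by positivity)).1 this
  have e0 : W 0 = V 0 := by
    have := mul_right_cancel₀ hFV.ne' hVy
    exact (div_left_inj' (by positivity)).1 this
  have e2 : W 2 = V 2 := by
    have hW' := sqrt_mul_sqrt_one_add_solAmplitude_sq hW0 hW1
    have hV' := sqrt_mul_sqrt_one_add_solAmplitude_sq hV0 hV1
    rw [hA, e0, e1, hV'] at hW'
    have h := (Real.sqrt_inj (by positivity) (by positivity)).1
      (mul_left_cancel₀ (by norm_num : (1 / 2 : ℝ) ≠ 0) hW')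
    exact (pow_left_inj₀ (hWn 2) (hVn 2) two_ne_zero).1 (by linarith)
  funext i
  fin_cases i
  · exact e0.symm
  · exact e1.symm
  · exact e2.symm
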